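/- **The Parameter Continuation Theorem.** Let $n,k\ge 0$ be integers and let $f_1,\dots,f_n\in\mathbb C[x_1,\dots,x_n,p_1,\dots,p_k]$ be polynomials in the variables $x=(x_1,\dots,x_n)$ and the parameters $p=(p_1,\dots,p_k)$. For $q\in\mathbb C^k$ write $F(x;q)=(f_1(x;q),\dots,f_n(x;q))$. A point $x\in\mathbb C^n$ is called a *regular zero* of $F(x;q)$ if $f_1(x;q)=\dots=f_n(x;q)=0$ and the Jacobian determinant $\det\big(\tfrac{\partial f_i}{\partial x_j}\big)_{1\le i,j\le n}$ does not vanish at $(x,q)$. Let $$N(q):=\#\{x\in\mathbb C^n \mid x\text{ is a regular zero of }F(x;q)\}\in\mathbb N\cup\{\infty\},\qquad N:=\sup_{q\in\mathbb C^k}N(q).$$ Then $N<\infty$, and there exists a proper algebraic subvariety $\Delta\subsetneq\mathbb C^k$ (the common zero set of a set of polynomials in $\mathbb C[p_1,\dots,p_k]$, not necessarily irreducible and possibly empty) such that $N(q)=N$ for all $q\in\mathbb C^k\setminus\Delta$. -/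

import Mathlib

open MvPolynomial

noncomputable section

/-- The Jacobian determinant `det (∂fᵢ/∂xⱼ)` with respect to the variables `x` of a family of `n`
polynomials in the variables `x = (x₁, …, xₙ)` (left summand) and the parameters
`p = (p₁, …, pₖ)` (right summand). -/
def jacobianDet {n k : ℕ} (F : Fin n → MvPolynomial (Fin n ⊕ Fin k) ℂ) :
    MvPolynomial (Fin n ⊕ Fin k) ℂ :=
  (Matrix.of fun i j : Fin n => pderiv (Sum.inl j) (F i)).det

/-- `x` is a regular zero of the system `F(x; q)`: all the equations hold, and the Jacobian
determinant does not vanish at `(x, q)`. -/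
def IsRegularZero {n k : ℕ} (F : Fin n → MvPolynomial (Fin n ⊕ Fin k) ℂ)
    (q : Fin k → ℂ) (x : Fin n → ℂ) : Prop :=
  (∀ i, eval (Sum.elim x q) (F i) = 0) ∧ eval (Sum.elim x q) (jacobianDet F) ≠ 0

/-- The number `N(q)` of regular zeros of `F(x; q)`, with value `⊤` when there are infinitely
many of them. -/
def numRegularZeros {n k : ℕ} (F : Fin n → MvPolynomial (Fin n ⊕ Fin k) ℂ)
    (q : Fin k → ℂ) : ℕ∞ :=
  {x : Fin n → ℂ | IsRegularZero F q x}.encard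

/-- An algebraic subvariety of `ℂᵏ` (not necessarily irreducible): the set of common zeros of
the polynomials in some ideal. -/
def IsAlgebraicSubvariety {k : ℕ} (Δ : Set (Fin k → ℂ)) : Prop :=
  ∃ I : Ideal (MvPolynomial (Fin k) ℂ), Δ = zeroLocus ℂ I

end

/-! An algebraic argument gives a generic count, and an analytic one bounds all other counts by it.
Let `A = ℂ[p]` and let `B` be `A[x]/(F)` with the Jacobian determinant inverted. The regular zeros
at `q` are the `A`-algebra maps `B → ℂ` over `q`. Inverting the Jacobian kills the differentials of
`B` over `A`, so `B` is unramified and, over `Frac A`, finite. Clearing denominators makes `B` free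
of some rank `d` after inverting one `a ≠ 0`. Where `a(q) ≠ 0` the fibre is an unramified
`ℂ`-algebra of dimension `d`, a product of `d` copies of `ℂ`, so `N(q) = d`
(`exists_forall_card_algHom_eq`). By the open mapping form of the implicit function theorem, regular
zeros persist nearby, so `N` is lower semicontinuous. As `{a ≠ 0}` is dense, `N ≤ d` everywhere
(`numRegularZeros_le_of_dense`). Hence the supremum is `d` and `Δ = {a = 0}` works. -/

/-! ### Polynomial functions on complex affine space -/

/-- A polynomial function is strictly differentiable, with the expected differential. -/
theorem hasStrictFDerivAt_eval {σ : Type*} [Fintype σ] (p : MvPolynomial σ ℂ) (z : σ → ℂ) :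
    HasStrictFDerivAt (fun z : σ → ℂ => eval z p)
      (∑ j, eval z (pderiv j p) • ContinuousLinearMap.proj (R := ℂ) (φ := fun _ : σ => ℂ) j) z := by
  classical
  induction p using MvPolynomial.induction_on with
  | C a =>
    refine ((hasStrictFDerivAt_const (𝕜 := ℂ) a z).congr_fderiv ?_).congr_of_eventuallyEq
      (.of_forall fun w => by simp)
    ext v
    simp
  | add p q hp hq =>
    refine ((hp.add hq).congr_fderiv ?_).congr_of_eventuallyEq (.of_forall fun w => by simp)
    ext v
    simp [add_mul, Finset.sum_add_distrib]
  | mul_X p i hp =>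
    have h := hp.mul (ContinuousLinearMap.proj (R := ℂ) (φ := fun _ : σ => ℂ) i).hasStrictFDerivAt
    refine (h.congr_fderiv ?_).congr_of_eventuallyEq (.of_forall fun w => by simp)
    ext v
    simp [Derivation.leibniz, pderiv_X, Pi.single_apply, add_mul, Finset.sum_add_distrib,
      Finset.mul_sum, mul_assoc, apply_ite]

/-- The complement of a hypersurface is dense. -/
theorem dense_eval_ne_zero {σ : Type*} [Finite σ] {a : MvPolynomial σ ℂ} (ha : a ≠ 0) :
    Dense {q : σ → ℂ | eval q a ≠ 0} := by
  cases nonempty_fintype σ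
  refine Metric.dense_iff.mpr fun q r hr => ?_
  -- A sup-norm ball is a product of infinite discs, and a polynomial vanishing on such a product is
  -- zero.
  by_contra! h
  refine ha (MvPolynomial.funext_set (fun i => Metric.ball (q i) r)
    (fun i => infinite_of_mem_nhds (q i) (Metric.ball_mem_nhds _ hr)) fun x hx => ?_)
  by_contra hxa
  exact Set.notMem_empty x (h ▸ ⟨by rwa [ball_pi _ hr], by simpa using hxa⟩)

/-! ### Persistence of regular zeros and semicontinuity -/

section persistence

open Topology Filter

variable {n k : ℕ} (F : Fin n → MvPolynomial (Fin n ⊕ Fin k) ℂ)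

theorem eval_jacobianDet (z : Fin n ⊕ Fin k → ℂ) :
    eval z (jacobianDet F) =
      (Matrix.of fun i j : Fin n => eval z (pderiv (Sum.inl j) (F i))).det := by
  rw [jacobianDet, RingHom.map_det]
  rfl

/-- At a regular zero, the map `(x, q) ↦ (F(x; q), q)` is open. -/
theorem IsRegularZero.map_nhds_eq {q : Fin k → ℂ} {x : Fin n → ℂ} (h : IsRegularZero F q x) :
    map (fun z : Fin n ⊕ Fin k → ℂ => ((fun i => eval z (F i), z ∘ Sum.inr) :
      (Fin n → ℂ) × (Fin k → ℂ))) (𝓝 (Sum.elim x q)) = 𝓝 (0, q) := by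
  set z₀ := Sum.elim x q with hz₀
  have hd := (hasStrictFDerivAt_pi.2 fun i => hasStrictFDerivAt_eval (F i) z₀).prodMk
    (ContinuousLinearMap.pi fun j : Fin k => ContinuousLinearMap.proj (R := ℂ)
      (φ := fun _ : Fin n ⊕ Fin k => ℂ) (Sum.inr j)).hasStrictFDerivAt
  have key := hd.map_nhds_eq_of_surj ?_
  · have h0 : (fun i => eval z₀ (F i)) = 0 := funext h.1
    rw [h0] at key
    exact key
  · rw [LinearMap.range_eq_top]
    rintro ⟨w, r⟩
    set J : Matrix (Fin n) (Fin n) ℂ := Matrix.of fun i j => eval z₀ (pderiv (Sum.inl j) (F i))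
    have hJ : IsUnit J.det := by
      rw [isUnit_iff_ne_zero, ← eval_jacobianDet]
      exact h.2
    -- The differential is block triangular, `(v, r) ↦ (J v + ∂F/∂p r, r)`; solve for `v`.
    set w' : Fin n → ℂ := fun i => w i - ∑ j, eval z₀ (pderiv (Sum.inr j) (F i)) * r j
    refine ⟨Sum.elim (J⁻¹.mulVec w') r, Prod.ext ?_ ?_⟩
    · funext i
      have hv : J.mulVec (J⁻¹.mulVec w') i = w' i := by
        rw [Matrix.mulVec_mulVec, Matrix.mul_nonsing_inv _ hJ, Matrix.one_mulVec]
      rw [Matrix.mulVec, dotProduct] at hv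
      simp only [J, Matrix.of_apply] at hv
      simp [Fintype.sum_sum_type]
      simp only [J]
      rw [hv]
      simp [w']
    · funext j
      simp

/-- A regular zero persists under small changes of the parameters. -/
theorem IsRegularZero.eventually_exists {q : Fin k → ℂ} {x : Fin n → ℂ} (h : IsRegularZero F q x)
    {U : Set (Fin n → ℂ)} (hU : U ∈ 𝓝 x) : ∀ᶠ q' in 𝓝 q, ∃ y ∈ U, IsRegularZero F q' y := by
  set z₀ := Sum.elim x q with hz₀
  have hc : Continuous fun z : Fin n ⊕ Fin k → ℂ => eval z (jacobianDet F) :=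
    MvPolynomial.continuous_eval _
  have hinl : Continuous fun z : Fin n ⊕ Fin k → ℂ => z ∘ Sum.inl := by fun_prop
  have h1 : ∀ᶠ z in 𝓝 z₀, z ∘ Sum.inl ∈ U ∧ eval z (jacobianDet F) ≠ 0 :=
    (hinl.continuousAt.eventually (by simpa [hz₀] using hU)).and
      (hc.continuousAt.eventually_ne h.2)
  have h2 := Filter.image_mem_map (m := fun z : Fin n ⊕ Fin k → ℂ =>
    ((fun i => eval z (F i), z ∘ Sum.inr) : (Fin n → ℂ) × (Fin k → ℂ))) h1
  rw [h.map_nhds_eq] at h2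
  -- Restrict to the slice `{0} × ℂᵏ`, over which preimages are zeros of the system.
  have h3 : Tendsto (fun q' : Fin k → ℂ => ((0 : Fin n → ℂ), q')) (𝓝 q) (𝓝 (0, q)) :=
    (Continuous.prodMk_right _).continuousAt
  filter_upwards [h3 h2] with q' hq'
  obtain ⟨z, ⟨hzU, hzJ⟩, hz⟩ := hq'
  have hz1 := congrArg Prod.fst hz
  have hz2 : z ∘ Sum.inr = q' := congrArg Prod.snd hz
  have hz3 : Sum.elim (z ∘ Sum.inl) q' = z := by rw [← hz2, Sum.elim_comp_inl_inr]
  exact ⟨z ∘ Sum.inl, hzU, fun i => by rw [hz3]; exact congrFun hz1 i, by rwa [hz3]⟩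

/-- The number of regular zeros is lower semicontinuous in the parameters. -/
theorem eventually_card_le_numRegularZeros {q : Fin k → ℂ} (s : Finset (Fin n → ℂ))
    (hs : ∀ x ∈ s, IsRegularZero F q x) : ∀ᶠ q' in 𝓝 q, (s.card : ℕ∞) ≤ numRegularZeros F q' := by
  -- Disjoint neighbourhoods keep the perturbed zeros distinct.
  obtain ⟨U, hU, hdisj⟩ := s.finite_toSet.t2_separation
  have h : ∀ᶠ q' in 𝓝 q, ∀ x ∈ s, ∃ y ∈ U x, IsRegularZero F q' y :=
    (Filter.eventually_all_finset s).2 fun x hx =>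
      (hs x hx).eventually_exists F ((hU x).2.mem_nhds (hU x).1)
  filter_upwards [h] with q' hq'
  choose! y hyU hy using hq'
  rw [← Set.encard_coe_eq_coe_finsetCard, ← Set.InjOn.encard_image (f := y)]
  · exact Set.encard_le_encard (Set.image_subset_iff.2 fun x hx => hy x hx)
  · intro x hx x' hx' hxx'
    by_contra hne
    exact Set.disjoint_left.1 (hdisj hx hx' hne) (hyU x hx) (hxx' ▸ hyU x' hx')

/-- A bound on the number of regular zeros for a dense set of parameters holds everywhere. -/
theorem numRegularZeros_le_of_dense {S : Set (Fin k → ℂ)} (hS : Dense S) {d : ℕ∞}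
    (hd : ∀ q ∈ S, numRegularZeros F q ≤ d) (q : Fin k → ℂ) : numRegularZeros F q ≤ d := by
  -- Testing against finite `m` also covers a possibly infinite `N(q)`.
  refine ENat.forall_natCast_le_iff_le.1 fun m hm => ?_
  obtain ⟨t, ht, htm⟩ := Set.exists_subset_encard_eq hm
  have htf : t.Finite := Set.finite_of_encard_eq_coe htm
  obtain ⟨q', hq'S, hq'⟩ := hS.inter_nhds_nonempty
    (eventually_card_le_numRegularZeros F htf.toFinset fun x hx => ht (htf.mem_toFinset.1 hx))
  rw [← htm, htf.encard_eq_coe_toFinset_card]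
  exact le_trans (by exact hq') (hd q' hq'S)

end persistence

/-! ### Unramified algebras and generic freeness -/

section

open TensorProduct

/-- A localization of `A[x]/(G)`, with `G` a square system, in which the Jacobian determinant of `G`
is invertible is formally unramified over `A`. -/
theorem formallyUnramified_of_isUnit_jacobian {A ι R B : Type*} [CommRing A] [Fintype ι]
    [DecidableEq ι] [CommRing R] [Algebra A R] [CommRing B] [Algebra A B] [Algebra R B]
    [IsScalarTower A R B] (M : Submonoid R) [IsLocalization M B]
    (π : MvPolynomial ι A →ₐ[A] R) (hπ : Function.Surjective π)
    (G : ι → MvPolynomial ι A) (hG : ∀ i, π (G i) = 0)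
    (hJ : IsUnit (algebraMap R B (π (Matrix.of fun i j => pderiv j (G i)).det))) :
    Algebra.FormallyUnramified A B := by
  constructor
  let _ : Algebra (MvPolynomial ι A) B := ((IsScalarTower.toAlgHom A R B).comp π).toAlgebra
  have _ : IsScalarTower A (MvPolynomial ι A) B :=
    .of_algHom ((IsScalarTower.toAlgHom A R B).comp π)
  have hmap : ∀ p, algebraMap (MvPolynomial ι A) B p = algebraMap R B (π p) := fun _ => rfl
  let D : Derivation A (MvPolynomial ι A) Ω[B⁄A] :=
    (KaehlerDifferential.D A B).compAlgebraMap (MvPolynomial ι A)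
  have hD : ∀ p, D p = KaehlerDifferential.D A B (algebraMap R B (π p)) := fun _ => rfl
  have hexp : ∀ p, D p = ∑ j, pderiv j p • D (X j) := by
    let D' : Derivation A (MvPolynomial ι A) Ω[B⁄A] := ∑ j, (LinearMap.toSpanSingleton
      (MvPolynomial ι A) Ω[B⁄A] (D (X j))).compDer (pderiv j)
    have hD' : ∀ p, D' p = ∑ j, pderiv j p • D (X j) := fun p => by
      simp only [D', ← Derivation.coeFnAddMonoidHom_apply, map_sum, Finset.sum_apply]
      rfl
    have : D = D' := MvPolynomial.derivation_ext fun i => by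
      rw [hD', Finset.sum_eq_single i]
      · simp
      · intro j _ hj
        simp [pderiv_X, hj.symm]
      · simp
    intro p
    rw [← hD', this]
  set J : Matrix ι ι (MvPolynomial ι A) := Matrix.of fun i j => pderiv j (G i)
  -- Cramer's rule: `dG = 0` reads `J dx = 0`, so the adjugate gives `det J • dx = 0`, and `det J`
  -- is a unit in `B`.
  have hX : ∀ i, D (X i) = 0 := fun i => by
    have h0 : J.det • D (X i) = 0 := by
      calc J.det • D (X i) = ∑ j, (J.adjugate * J) i j • D (X j) := by
            rw [Matrix.adjugate_mul, Finset.sum_eq_single i]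
            · simp
            · intro j _ hj
              simp [Matrix.one_apply_ne hj.symm]
            · simp
        _ = ∑ l, J.adjugate i l • D (G l) := by
            simp only [Matrix.mul_apply, Finset.sum_smul, hexp (G _), Finset.smul_sum, mul_smul]
            exact Finset.sum_comm
        _ = 0 := Finset.sum_eq_zero fun l _ => by simp [hD, hG]
    rw [← algebraMap_smul B, hmap] at h0
    exact (hJ.smul_eq_zero).1 h0
  have hR : ∀ r, KaehlerDifferential.D A B (algebraMap R B r) = 0 := fun r => by
    obtain ⟨p, rfl⟩ := hπ r
    rw [← hD, hexp]
    simp [hX]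
  have hB : ∀ b, KaehlerDifferential.D A B b = 0 := fun b => by
    obtain ⟨⟨r, s⟩, hrs⟩ := IsLocalization.surj M b
    have h := congrArg (KaehlerDifferential.D A B) hrs
    simp only [Derivation.leibniz, hR, smul_zero, zero_add] at h
    exact ((IsLocalization.map_units B s).smul_eq_zero).1 h
  refine (Submodule.subsingleton_iff B).1 (subsingleton_of_bot_eq_top ?_)
  rw [← KaehlerDifferential.span_range_derivation, eq_comm, Submodule.span_eq_bot]
  rintro _ ⟨b, rfl⟩
  exact hB b

/-- A finite étale algebra over an algebraically closed field has as many points as its degree. -/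
theorem card_algHom_eq_finrank {Ω C : Type*} [Field Ω] [IsAlgClosed Ω] [CommRing C]
    [Algebra Ω C] [Algebra.EssFiniteType Ω C] [Algebra.FormallyUnramified Ω C] :
    ENat.card (C →ₐ[Ω] Ω) = Module.finrank Ω C := by
  classical
  have := Algebra.FormallyEtale.of_formallyUnramified_of_field Ω C
  have := Algebra.FormallyUnramified.finite_of_free Ω C
  have : IsArtinianRing C := isArtinian_of_tower Ω inferInstance
  let e := Algebra.FormallyEtale.equivPiOfIsSepClosed Ω C
  cases nonempty_fintype (PrimeSpectrum C)
  rw [e.toLinearEquiv.finrank_eq, Module.finrank_fintype_fun_eq_card, ← ENat.card_eq_coe_fintype_card]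
  refine (ENat.card_congr (Equiv.ofBijective
    (fun p => (Pi.evalAlgHom Ω (fun _ : PrimeSpectrum C => Ω) p).comp e.toAlgHom) ⟨?_, ?_⟩)).symm
  · intro p p' h
    by_contra hne
    have := DFunLike.congr_fun h (e.symm (Pi.single p 1))
    simp [Ne.symm hne] at this
  · intro f
    let g : (PrimeSpectrum C → Ω) →ₐ[Ω] Ω := f.comp e.symm.toAlgHom
    -- The idempotents sum to `1`, so `g` is nonzero on one of them; this forces `g` to be
    -- evaluation there.
    obtain ⟨p, hp⟩ : ∃ p, g (Pi.single p 1) ≠ 0 := by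
      by_contra! h
      have h1 : g 1 = 0 := by
        rw [← Finset.univ_sum_single (1 : PrimeSpectrum C → Ω), map_sum]
        exact Finset.sum_eq_zero fun p _ => h p
      simp at h1
    refine ⟨p, AlgHom.ext fun c => mul_right_cancel₀ hp ?_⟩
    have hc : f c = g (e c) := by simp [g]
    rw [hc, ← map_mul]
    have : e c * Pi.single p 1 = e c p • Pi.single p 1 := by
      ext p'
      by_cases h : p' = p
      · subst h; simp
      · simp [h]
    rw [this, map_smul]
    rfl

/-- If a submodule spans after base change to the fraction field, each element of a finite set
has a nonzero multiple in it. -/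
theorem exists_ne_zero_forall_smul_mem {A M : Type*} [CommRing A] [IsDomain A] [AddCommGroup M]
    [Module A M] (N : Submodule A M)
    (hN : Submodule.span (FractionRing A) ((fun m => (1 : FractionRing A) ⊗ₜ[A] m) '' (N : Set M)) = ⊤)
    (T : Finset M) : ∃ a : A, a ≠ 0 ∧ ∀ m ∈ T, a • m ∈ N := by
  classical
  let K := FractionRing A
  induction T using Finset.induction_on with
  | empty => exact ⟨1, one_ne_zero, by simp⟩
  | insert m T _ ih =>
    obtain ⟨a, ha, haT⟩ := ih
    suffices ∃ b : A, b ≠ 0 ∧ b • m ∈ N by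
      obtain ⟨b, hb, hbm⟩ := this
      refine ⟨a * b, mul_ne_zero ha hb, fun m' hm' => ?_⟩
      rcases Finset.mem_insert.1 hm' with rfl | h
      · rw [mul_smul]; exact N.smul_mem _ hbm
      · rw [mul_comm, mul_smul]; exact N.smul_mem _ (haT _ h)
    have hloc : N.localized' K (nonZeroDivisors A) (TensorProduct.mk A K M 1) = ⊤ := by
      rw [← top_le_iff, ← hN, Submodule.span_le]
      rintro _ ⟨x, hx, rfl⟩
      exact ⟨x, hx, 1, by simp⟩
    obtain ⟨x, hx, s, hs⟩ := (hloc ▸ Submodule.mem_top :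
      (1 : K) ⊗ₜ[A] m ∈ N.localized' K (nonZeroDivisors A) (TensorProduct.mk A K M 1))
    rw [IsLocalizedModule.mk'_eq_iff] at hs
    have hs' : TensorProduct.mk A K M 1 x = TensorProduct.mk A K M 1 ((s : A) • m) := by
      rw [hs, map_smul]; rfl
    -- `M` may have torsion: equality after base change only holds in `M` up to a factor `t`.
    obtain ⟨t, ht⟩ := (IsLocalizedModule.eq_iff_exists (nonZeroDivisors A) _).1 hs'
    refine ⟨t * s, mul_ne_zero (nonZeroDivisors.ne_zero t.2) (nonZeroDivisors.ne_zero s.2), ?_⟩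
    rw [mul_smul]
    have : (t : A) • (s : A) • m = (t : A) • x := ht.symm
    rw [this]
    exact N.smul_mem _ hx

/-- An algebra of finite type that is finite over the fraction field becomes free of finite rank
after inverting a nonzero element of the base. -/
theorem exists_basis_localizationAway {A B : Type*} [CommRing A] [IsDomain A] [CommRing B]
    [Algebra A B] [Algebra.FiniteType A B]
    [Module.Finite (FractionRing A) (FractionRing A ⊗[A] B)] :
    ∃ a : A, a ≠ 0 ∧ ∃ d : ℕ, Nonempty
      (Module.Basis (Fin d) (Localization.Away a) (Localization.Away a ⊗[A] B)) := by
  classical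
  let K := FractionRing A
  have hspan : (⊤ : Submodule K (K ⊗[A] B)) ≤
      Submodule.span K (Set.range fun b : B => (1 : K) ⊗ₜ[A] b) := by
    intro x _
    induction x using TensorProduct.induction_on with
    | zero => exact zero_mem _
    | tmul c b =>
      have : c ⊗ₜ[A] b = c • ((1 : K) ⊗ₜ[A] b) := by simp [TensorProduct.smul_tmul']
      rw [this]
      exact Submodule.smul_mem _ _ (Submodule.subset_span ⟨b, rfl⟩)
    | add x y hx hy => exact add_mem (hx trivial) (hy trivial)
  let v₀ := Module.Basis.ofSpan hspan
  let v := v₀.reindex (Finite.equivFin _)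
  choose u hu using fun i => Module.Basis.ofSpan_subset hspan ⟨(Finite.equivFin _).symm i, rfl⟩
  have hv : ∀ i, v i = (1 : K) ⊗ₜ[A] u i := fun i => by
    rw [Module.Basis.reindex_apply]; exact (hu i).symm
  let N : Submodule A B := Submodule.span A (Set.range u)
  have hN : Submodule.span K ((fun b => (1 : K) ⊗ₜ[A] b) '' (N : Set B)) = ⊤ := by
    rw [← top_le_iff, ← v.span_eq, Submodule.span_le]
    rintro _ ⟨i, rfl⟩
    exact Submodule.subset_span ⟨u i, Submodule.subset_span ⟨i, rfl⟩, (hv i).symm⟩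
  obtain ⟨g, hg⟩ := Algebra.FiniteType.out (R := A) (A := B)
  -- After inverting `a`, the span of the `u i` contains `1` and is stable under the algebra
  -- generators `g`, hence is everything.
  obtain ⟨a, ha, haN⟩ := exists_ne_zero_forall_smul_mem N hN
    (insert 1 (Finset.image₂ (fun x i => x * u i) g Finset.univ))
  refine ⟨a, ha, _, ⟨Module.Basis.mk (v := fun i => (1 : Localization.Away a) ⊗ₜ[A] u i) ?_ ?_⟩⟩
  -- Independence is checked in `K ⊗ B`, using `A_a ⊆ K`.
  · have hle : Submonoid.powers a ≤ nonZeroDivisors A :=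
      powers_le_nonZeroDivisors_of_noZeroDivisors ha
    let _ : Algebra (Localization.Away a) K := (IsLocalization.map (T := nonZeroDivisors A) K
      (RingHom.id A) hle).toAlgebra
    have _ : IsScalarTower A (Localization.Away a) K := .of_algebraMap_eq fun x =>
      (IsLocalization.map_eq (M := Submonoid.powers a) (S := Localization.Away a)
        (T := nonZeroDivisors A) (g := RingHom.id A) hle x).symm
    have hinj : Function.Injective (algebraMap (Localization.Away a) K) :=
      have := IsFractionRing.isFractionRing_of_isDomain_of_isLocalization (Submonoid.powers a)
        (Localization.Away a) K
      IsFractionRing.injective _ _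
    have hli : LinearIndependent (Localization.Away a) v :=
      v.linearIndependent.restrict_scalars fun x y hxy => hinj (by
        simpa [Algebra.smul_def] using hxy)
    let φ : Localization.Away a ⊗[A] B →ₗ[Localization.Away a] K ⊗[A] B :=
      TensorProduct.AlgebraTensorModule.map (Algebra.linearMap _ K) LinearMap.id
    refine LinearIndependent.of_comp φ ?_
    convert hli using 1
    funext i
    have hφ : φ (1 ⊗ₜ[A] u i) = 1 ⊗ₜ[A] u i := by
      rw [TensorProduct.AlgebraTensorModule.map_tmul]
      simp
    exact hφ.trans (hv i).symm
  · set W := Submodule.span (Localization.Away a)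
      (Set.range fun i => (1 : Localization.Away a) ⊗ₜ[A] u i)
    have ha_unit : IsUnit (algebraMap A (Localization.Away a) a) :=
      IsLocalization.Away.algebraMap_isUnit a
    have hNW : ∀ b ∈ N, (1 : Localization.Away a) ⊗ₜ[A] b ∈ W := fun b hb => by
      have : N ≤ (W.restrictScalars A).comap (TensorProduct.mk A (Localization.Away a) B 1) :=
        Submodule.span_le.2 (by rintro _ ⟨i, rfl⟩; exact Submodule.subset_span ⟨i, rfl⟩)
      exact this hb
    have hWa : ∀ b : B, a • b ∈ N → (1 : Localization.Away a) ⊗ₜ[A] b ∈ W := fun b hb => by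
      have := hNW _ hb
      rw [TensorProduct.tmul_smul, ← algebraMap_smul (Localization.Away a)] at this
      exact (W.smul_mem_iff_of_isUnit ha_unit).1 this
    -- The stabiliser of `W` is a subalgebra, so it suffices that it contains generators.
    let S : Subalgebra A B :=
      { carrier := {b | ∀ w ∈ W, ((1 : Localization.Away a) ⊗ₜ[A] b) * w ∈ W}
        mul_mem' := fun {x y} hx hy w hw => by
          have : (1 : Localization.Away a) ⊗ₜ[A] (x * y) = (1 ⊗ₜ[A] x) * (1 ⊗ₜ[A] y) := by simp
          rw [this, mul_assoc]
          exact hx _ (hy _ hw)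
        add_mem' := fun {x y} hx hy w hw => by
          rw [TensorProduct.tmul_add, add_mul]
          exact add_mem (hx _ hw) (hy _ hw)
        algebraMap_mem' := fun r w hw => by
          rw [Algebra.algebraMap_eq_smul_one, TensorProduct.tmul_smul,
            ← algebraMap_smul (Localization.Away a), smul_mul_assoc,
            ← Algebra.TensorProduct.one_def, one_mul]
          exact W.smul_mem _ hw }
    have hS : S = ⊤ := by
      rw [← top_le_iff, ← hg, Algebra.adjoin_le_iff]
      intro x hx w hw
      induction hw using Submodule.span_induction with
      | mem w hw =>
        obtain ⟨i, rfl⟩ := hw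
        rw [Algebra.TensorProduct.tmul_mul_tmul, one_mul]
        exact hWa _ (haN _ (Finset.mem_insert_of_mem
          (Finset.mem_image₂_of_mem hx (Finset.mem_univ i))))
      | zero => simp
      | add w w' _ _ h h' => rw [mul_add]; exact add_mem h h'
      | smul c w _ h => rw [mul_smul_comm]; exact W.smul_mem _ h
    intro x _
    induction x using TensorProduct.induction_on with
    | zero => exact zero_mem _
    | tmul c b =>
      have hb : b ∈ S := hS ▸ Algebra.mem_top
      have h1 := hb _ (hWa 1 (haN 1 (Finset.mem_insert_self _ _)))
      rw [Algebra.TensorProduct.tmul_mul_tmul, one_mul, mul_one] at h1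
      have : c ⊗ₜ[A] b = c • ((1 : Localization.Away a) ⊗ₜ[A] b) := by
        simp [TensorProduct.smul_tmul']
      rw [this]
      exact W.smul_mem _ h1
    | add x y hx hy => exact add_mem (hx trivial) (hy trivial)

/-- An unramified algebra of finite type over a domain has, generically on the base, a constant
number of geometric points. -/
theorem exists_forall_card_algHom_eq (A B : Type*) [CommRing A] [IsDomain A] [CommRing B]
    [Algebra A B] [Algebra.FiniteType A B] [Algebra.FormallyUnramified A B] :
    ∃ a : A, a ≠ 0 ∧ ∃ d : ℕ, ∀ (Ω : Type) [Field Ω] [IsAlgClosed Ω] [Algebra A Ω],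
      algebraMap A Ω a ≠ 0 → ENat.card (B →ₐ[A] Ω) = d := by
  have _ := Algebra.FormallyUnramified.finite_of_free (FractionRing A) (FractionRing A ⊗[A] B)
  obtain ⟨a, ha, d, ⟨v⟩⟩ := exists_basis_localizationAway (A := A) (B := B)
  refine ⟨a, ha, d, fun Ω _ _ _ haΩ => ?_⟩
  -- Since `a` is nonzero in `Ω`, the map `A → Ω` factors through `A_a`, and the rank `d` passes to
  -- `Ω ⊗ B`.
  let _ : Algebra (Localization.Away a) Ω :=
    (IsLocalization.Away.lift (S := Localization.Away a) a haΩ.isUnit).toAlgebra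
  have _ : IsScalarTower A (Localization.Away a) Ω := .of_algebraMap_eq fun x =>
    (IsLocalization.Away.lift_eq a haΩ.isUnit x).symm
  rw [ENat.card_congr (AlgHom.liftEquiv A Ω B Ω), card_algHom_eq_finrank,
    ← (TensorProduct.AlgebraTensorModule.cancelBaseChange A (Localization.Away a) Ω Ω
      B).finrank_eq, Module.finrank_eq_card_basis (v.baseChange Ω), Fintype.card_fin]

end

/-! ### Points of the nondegenerate locus -/

section points

/-- The coordinate ring of the scheme of nondegenerate solutions of a square polynomial system. -/
abbrev NondegenerateLocus {A ι : Type*} [CommRing A] [Fintype ι] [DecidableEq ι]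
    (G : ι → MvPolynomial ι A) : Type _ :=
  Localization.Away (Ideal.Quotient.mk (Ideal.span (Set.range G))
    (Matrix.of fun i j => pderiv j (G i)).det)

variable {A ι : Type*} [CommRing A] [Fintype ι] [DecidableEq ι] (G : ι → MvPolynomial ι A)

instance NondegenerateLocus.formallyUnramified :
    Algebra.FormallyUnramified A (NondegenerateLocus G) :=
  formallyUnramified_of_isUnit_jacobian
    (Submonoid.powers (Ideal.Quotient.mk (Ideal.span (Set.range G))
      (Matrix.of fun i j => pderiv j (G i)).det))
    (Ideal.Quotient.mkₐ A (Ideal.span (Set.range G))) (Ideal.Quotient.mkₐ_surjective A _) G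
    (fun i => Ideal.Quotient.eq_zero_iff_mem.2 (Ideal.subset_span ⟨i, rfl⟩))
    (IsLocalization.Away.algebraMap_isUnit (Ideal.Quotient.mk (Ideal.span (Set.range G))
      (Matrix.of fun i j => pderiv j (G i)).det))

instance NondegenerateLocus.finiteType : Algebra.FiniteType A (NondegenerateLocus G) :=
  have : Algebra.FiniteType (MvPolynomial ι A ⧸ Ideal.span (Set.range G)) (NondegenerateLocus G) :=
    IsLocalization.finiteType_of_monoid_fg (Submonoid.powers (Ideal.Quotient.mk
      (Ideal.span (Set.range G)) (Matrix.of fun i j => pderiv j (G i)).det)) _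
  .trans (S := MvPolynomial ι A ⧸ Ideal.span (Set.range G)) inferInstance this

/-- Points of the nondegenerate locus with values in a field are nondegenerate solutions. -/
theorem card_algHom_nondegenerateLocus (Ω : Type*) [Field Ω] [Algebra A Ω] :
    ENat.card (NondegenerateLocus G →ₐ[A] Ω) =
      {x : ι → Ω | (∀ i, aeval x (G i) = 0) ∧
        aeval x (Matrix.of fun i j => pderiv j (G i)).det ≠ 0}.encard := by
  set I := Ideal.span (Set.range G)
  set J := (Matrix.of fun i j => pderiv j (G i)).det
  let π : MvPolynomial ι A →ₐ[A] NondegenerateLocus G :=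
    (IsScalarTower.toAlgHom A (MvPolynomial ι A ⧸ I) _).comp (Ideal.Quotient.mkₐ A I)
  have hf : ∀ (f : NondegenerateLocus G →ₐ[A] Ω) p, f (π p) = aeval (fun j => f (π (X j))) p :=
    fun f p => DFunLike.congr_fun (MvPolynomial.algHom_ext (f := f.comp π) fun j => by simp) p
  have hπG : ∀ i, π (G i) = 0 := fun i => by
    have : Ideal.Quotient.mk I (G i) = 0 :=
      Ideal.Quotient.eq_zero_iff_mem.2 (Ideal.subset_span ⟨i, rfl⟩)
    simp [π, this]
  have hπJ : IsUnit (π J) := IsLocalization.Away.algebraMap_isUnit (Ideal.Quotient.mk I J)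
  refine ENat.card_congr (Equiv.ofBijective (fun f => ⟨fun j => f (π (X j)), ?_, ?_⟩) ⟨?_, ?_⟩)
  · intro i
    rw [← hf, hπG, map_zero]
  · rw [← hf]
    exact (hπJ.map f).ne_zero
  · intro f g hfg
    have hfg' : (fun j => f (π (X j))) = fun j => g (π (X j)) := congrArg Subtype.val hfg
    refine IsLocalization.algHom_ext (Submonoid.powers (Ideal.Quotient.mk I J))
      (AlgHom.ext fun r => ?_)
    obtain ⟨p, rfl⟩ := Ideal.Quotient.mk_surjective r
    exact (hf f p).trans ((congrArg (fun x => aeval x p) hfg').trans (hf g p).symm)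
  · rintro ⟨x, hx, hxJ⟩
    let φ : MvPolynomial ι A ⧸ I →ₐ[A] Ω := Ideal.Quotient.liftₐ I (aeval x) fun p hp => by
      have : I ≤ RingHom.ker (aeval x : MvPolynomial ι A →ₐ[A] Ω) :=
        Ideal.span_le.2 (by rintro _ ⟨i, rfl⟩; exact hx i)
      exact this hp
    have hφmk : ∀ p, φ (Ideal.Quotient.mk I p) = aeval x p := fun _ => rfl
    have hφ : ∀ y : Submonoid.powers (Ideal.Quotient.mk I J), IsUnit (φ y) := by
      rintro ⟨_, m, rfl⟩
      have h : IsUnit (φ (Ideal.Quotient.mk I J)) := isUnit_iff_ne_zero.2 hxJ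
      simpa only [map_pow] using h.pow m
    refine ⟨IsLocalization.liftAlgHom (M := Submonoid.powers (Ideal.Quotient.mk I J)) (f := φ) hφ,
      Subtype.ext (funext fun j => ?_)⟩
    simpa [π] using hφmk (X j)

end points

/-! ### Generic count and conclusion -/

/-- Regular zeros at `q` are the points of the nondegenerate locus over `q`. -/
theorem numRegularZeros_eq_card_algHom {n k : ℕ} (F : Fin n → MvPolynomial (Fin n ⊕ Fin k) ℂ)
    (q : Fin k → ℂ) :
    letI : Algebra (MvPolynomial (Fin k) ℂ) ℂ := (eval q).toAlgebra
    numRegularZeros F q = ENat.card (NondegenerateLocus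
      (fun i => sumAlgEquiv ℂ (Fin n) (Fin k) (F i)) →ₐ[MvPolynomial (Fin k) ℂ] ℂ) := by
  let _ : Algebra (MvPolynomial (Fin k) ℂ) ℂ := (eval q).toAlgebra
  have hev : ∀ (x : Fin n → ℂ) p, aeval x (sumAlgEquiv ℂ (Fin n) (Fin k) p) =
      eval (Sum.elim x q) p := fun x p => by
    refine RingHom.congr_fun (f := ((aeval x : MvPolynomial (Fin n) (MvPolynomial (Fin k) ℂ)
      →ₐ[MvPolynomial (Fin k) ℂ] ℂ).toRingHom.comp
        (sumAlgEquiv ℂ (Fin n) (Fin k)).toRingEquiv.toRingHom)) ?_ p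
    refine MvPolynomial.ringHom_ext (fun c => ?_) ?_
    · simp [RingHom.algebraMap_toAlgebra]
    · rintro (i | i) <;> simp [RingHom.algebraMap_toAlgebra]
  rw [card_algHom_nondegenerateLocus, numRegularZeros]
  congr 1
  ext x
  have hJ : (Matrix.of fun i j => pderiv j (sumAlgEquiv ℂ (Fin n) (Fin k) (F i))).det =
      sumAlgEquiv ℂ (Fin n) (Fin k) (jacobianDet F) := by
    rw [jacobianDet, AlgEquiv.map_det]
    congr 1
    refine Matrix.ext fun i j => ?_
    exact pderiv_sumAlgEquiv j (F i)
  simp only [Set.mem_ofPred_eq, IsRegularZero, hJ, hev]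

/-- Generically in the parameters, the number of regular zeros is constant. -/
theorem exists_forall_numRegularZeros_eq {n k : ℕ}
    (F : Fin n → MvPolynomial (Fin n ⊕ Fin k) ℂ) :
    ∃ a : MvPolynomial (Fin k) ℂ, a ≠ 0 ∧ ∃ d : ℕ, ∀ q, eval q a ≠ 0 → numRegularZeros F q = d := by
  obtain ⟨a, ha, d, hd⟩ := exists_forall_card_algHom_eq (MvPolynomial (Fin k) ℂ)
    (NondegenerateLocus fun i => sumAlgEquiv ℂ (Fin n) (Fin k) (F i))
  refine ⟨a, ha, d, fun q hq => ?_⟩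
  let _ : Algebra (MvPolynomial (Fin k) ℂ) ℂ := (eval q).toAlgebra
  rw [numRegularZeros_eq_card_algHom]
  exact hd ℂ hq

theorem theorem1 (n k : ℕ) (F : Fin n → MvPolynomial (Fin n ⊕ Fin k) ℂ) :
    (⨆ q : Fin k → ℂ, numRegularZeros F q) < ⊤ ∧
      ∃ Δ : Set (Fin k → ℂ), IsAlgebraicSubvariety Δ ∧ Δ ⊂ Set.univ ∧
        ∀ q : Fin k → ℂ, q ∉ Δ →
          numRegularZeros F q = ⨆ q' : Fin k → ℂ, numRegularZeros F q' := by
  obtain ⟨a, ha, d, hd⟩ := exists_forall_numRegularZeros_eq F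
  have hdense := dense_eval_ne_zero ha
  obtain ⟨q₀, hq₀⟩ := hdense.nonempty
  have hsup : ⨆ q : Fin k → ℂ, numRegularZeros F q = d :=
    le_antisymm (iSup_le (numRegularZeros_le_of_dense F hdense fun q hq => (hd q hq).le))
      ((hd q₀ hq₀).symm.le.trans (le_iSup (numRegularZeros F) q₀))
  have hmem : ∀ q : Fin k → ℂ, q ∈ zeroLocus ℂ (Ideal.span {a}) ↔ eval q a = 0 := fun q => by
    rw [zeroLocus_span]
    simp [aeval_eq_eval]
  refine ⟨hsup ▸ ENat.natCast_lt_top d, zeroLocus ℂ (Ideal.span {a}), ⟨_, rfl⟩, ?_, fun q hq => ?_⟩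
  · exact (Set.ssubset_univ_iff).2 fun h => hq₀ ((hmem q₀).1 (h ▸ Set.mem_univ q₀))
  · rw [hsup]
    exact hd q fun h => hq ((hmem q).2 h)
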